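/- **Theorem 3.** Let $H \ge 0$ be the number of hidden layers and $d_0, d_1, \dots, d_{H+1}$ the layer widths, with $d_x := d_0$ (input) and $d_y := d_{H+1}$ (output), and suppose that $d_j \ge \min\{d_x, d_y\}$ for all $j$. For real matrices $W_j \in \mathbb{R}^{d_j \times d_{j-1}}$ ($1 \le j \le H+1$) write $W_{i:j} := W_i W_{i-1} \cdots W_j$ for $i \ge j$, and let $W_{j-1:j}$ be the identity matrix of size $d_{j-1}$. Let $\ell_0 : \mathbb{R}^{d_y \times d_x} \to \mathbb{R}$ be differentiable, with gradient $\nabla \ell_0$ (the matrix of its partial derivatives), and put $$\ell\big((W_j)_{j=1}^{H+1}\big) := \ell_0(W_{H+1:1}).$$ A *critical point* is a point at which the derivative vanishes, and a *saddle* is a critical point that is neither a local minimum nor a local maximum. Then for every critical point $(\hat W_j)_{j=1}^{H+1}$ of $\ell$: 1. If $\nabla\ell_0(\hat W_{H+1:1}) \ne 0$, then $(\hat W_j)_{j=1}^{H+1}$ is a saddle of $\ell$. 2. If $\nabla\ell_0(\hat W_{H+1:1}) = 0$, then (a) if $\hat W_{H+1:1}$ is a local minimum (respectively, maximum) of $\ell_0$,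 then $(\hat W_j)_{j=1}^{H+1}$ is a local minimum (respectively, maximum) of $\ell$; (b) $(\hat W_j)_{j=1}^{H+1}$ is a global minimum (respectively, maximum) of $\ell$ if and only if $\hat W_{H+1:1}$ is a global minimum (respectively, maximum) of $\ell_0$. 3. If there exists $j^* \in \{1, \dots, H+1\}$ such that $\hat W_{H+1:j^*+1}$ has full row rank (rank $d_y$) and $\hat W_{j^*-1:1}$ has full column rank (rank $d_x$), then $\nabla\ell_0(\hat W_{H+1:1}) = 0$, so that 2(a) and 2(b) hold, and moreover, if $(\hat W_j)_{j=1}^{H+1}$ is a local minimum (respectively, maximum) of $\ell$, then $\hat W_{H+1:1}$ is a local minimum (respectively, maximum) of $\ell_0$. Hence $(\hat W_j)_{j=1}^{H+1}$ is a local minimum (respectively, maximum) of $\ell$ if and only if $\hat W_{H+1:1}$ is one of $\ell_0$. -/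

import Mathlib

open scoped Matrix.Norms.Frobenius

namespace DeepLinear

/-- The weight tuples of a linear network with `H` hidden layers. Layer `0` is the input, layer
`H + 1` the output, and `d k` is the width of layer `k`; only `d 0, …, d (H + 1)` are used.
The entry `W j` (with `j = 0, …, H`) is the matrix between layers `j` and `j + 1`, usually written
with the index `j + 1`. Matrices carry the Frobenius norm and tuples the product topology. -/
abbrev Weights (H : ℕ) (d : ℕ → ℕ) : Type :=
  ∀ j : Fin (H + 1), Matrix (Fin (d (j + 1))) (Fin (d j)) ℝ

variable {H : ℕ} {d : ℕ → ℕ}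

/-- The product of the matrices between layer `a` and layer `b`, for `a ≤ b ≤ H + 1`. With the
weight matrices numbered from `1`, this is `W_b W_{b-1} ⋯ W_{a+1}`; it is the identity if
`a = b`. -/
def partialProd (W : Weights H d) {a b : ℕ} (hab : a ≤ b) (hb : b ≤ H + 1) :
    Matrix (Fin (d b)) (Fin (d a)) ℝ :=
  Nat.leRec (motive := fun b _ => b ≤ H + 1 → Matrix (Fin (d b)) (Fin (d a)) ℝ)
    (fun _ => 1)
    (fun b _ P hb => (W ⟨b, hb⟩ : Matrix (Fin (d (b + 1))) (Fin (d b)) ℝ) * P (Nat.le_of_succ_le hb))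
    hab hb

theorem partialProd_self (W : Weights H d) {a : ℕ} (ha : a ≤ H + 1) :
    partialProd W (le_refl a) ha = 1 := by
  simp [partialProd, Nat.leRec_self]

theorem partialProd_succ (W : Weights H d) {a b : ℕ} (hab : a ≤ b) (hb : b + 1 ≤ H + 1) :
    partialProd W (Nat.le_succ_of_le hab) hb =
      (W ⟨b, hb⟩ : Matrix (Fin (d (b + 1))) (Fin (d b)) ℝ) *
        partialProd W hab (Nat.le_of_succ_le hb) := by
  simp [partialProd, Nat.leRec_succ _ _ hab]

/-- The end-to-end product `W_{H+1} ⋯ W_1` of all the weight matrices. -/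
def fullProd (W : Weights H d) : Matrix (Fin (d (H + 1))) (Fin (d 0)) ℝ :=
  partialProd W (Nat.zero_le (H + 1)) le_rfl

/-- The loss `ℓ(W_1, …, W_{H+1}) = ℓ₀(W_{H+1} ⋯ W_1)`. -/
def loss (l₀ : Matrix (Fin (d (H + 1))) (Fin (d 0)) ℝ → ℝ) (W : Weights H d) : ℝ :=
  l₀ (fullProd W)

/-- The gradient of a real function of a matrix: the matrix of its partial derivatives. -/
noncomputable def matrixGradient {m n : ℕ} (f : Matrix (Fin m) (Fin n) ℝ → ℝ)
    (M : Matrix (Fin m) (Fin n) ℝ) : Matrix (Fin m) (Fin n) ℝ :=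
  Matrix.of fun i j => fderiv ℝ f M (Matrix.single i j 1)

/-- A critical point of a real function: it is differentiable there, with zero derivative. -/
def IsCriticalPoint {E : Type*} [NormedAddCommGroup E] [NormedSpace ℝ E] (f : E → ℝ) (x : E) :
    Prop :=
  HasFDerivAt f (0 : E →L[ℝ] ℝ) x

/-- A saddle: a critical point that is neither a local minimum nor a local maximum. -/
def IsSaddle {E : Type*} [NormedAddCommGroup E] [NormedSpace ℝ E] (f : E → ℝ) (x : E) : Prop :=
  IsCriticalPoint f x ∧ ¬ IsLocalMin f x ∧ ¬ IsLocalMax f x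

/-- `x` is a global minimum of `f`. -/
def IsGlobalMin {E : Type*} (f : E → ℝ) (x : E) : Prop := ∀ y, f x ≤ f y

/-- `x` is a global maximum of `f`. -/
def IsGlobalMax {E : Type*} (f : E → ℝ) (x : E) : Prop := ∀ y, f y ≤ f x

end DeepLinear

namespace DeepLinear

open Matrix Filter Topology

section PartialProducts

variable {H : ℕ} {d : ℕ → ℕ}

theorem partialProd_congr {V W : Weights H d} {a b : ℕ} (hab : a ≤ b) (hb : b ≤ H + 1)
    (h : ∀ j : Fin (H + 1), a ≤ j → (j : ℕ) < b → V j = W j) :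
    partialProd V hab hb = partialProd W hab hb := by
  induction b, hab using Nat.le_induction with
  | base => rw [partialProd_self, partialProd_self]
  | succ b hab ih =>
    rw [partialProd_succ V hab hb, partialProd_succ W hab hb,
      ih (Nat.le_of_succ_le hb) fun j hj hj' => h j hj (hj'.trans b.lt_succ_self),
      h ⟨b, hb⟩ hab b.lt_succ_self]

theorem partialProd_mul_partialProd (W : Weights H d) {a b c : ℕ} (hab : a ≤ b) (hbc : b ≤ c)
    (hc : c ≤ H + 1) :
    partialProd W hbc hc * partialProd W hab (hbc.trans hc) =
      partialProd W (hab.trans hbc) hc := by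
  induction c, hbc using Nat.le_induction with
  | base => rw [partialProd_self, Matrix.one_mul]
  | succ c hbc ih =>
    rw [partialProd_succ W hbc hc, partialProd_succ W (hab.trans hbc) hc, Matrix.mul_assoc,
      ih (Nat.le_of_succ_le hc)]

theorem partialProd_mul_weight (W : Weights H d) {k c : ℕ} (hk : k < H + 1) (hkc : k + 1 ≤ c)
    (hc : c ≤ H + 1) :
    partialProd W hkc hc * (W ⟨k, hk⟩ : Matrix (Fin (d (k + 1))) (Fin (d k)) ℝ) =
      partialProd W ((Nat.le_succ k).trans hkc) hc := by
  rw [← partialProd_mul_partialProd W (Nat.le_succ k) hkc hc,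
    partialProd_succ W (le_refl k) hk, partialProd_self, Matrix.mul_one]

/-- The tuple `W` with the matrix between the layers `k` and `k + 1` replaced by `Y`. -/
def replaceLayer (W : Weights H d) {k : ℕ} (hk : k < H + 1)
    (Y : Matrix (Fin (d (k + 1))) (Fin (d k)) ℝ) : Weights H d :=
  Function.update W ⟨k, hk⟩ Y

theorem replaceLayer_same (W : Weights H d) {k : ℕ} (hk : k < H + 1)
    (Y : Matrix (Fin (d (k + 1))) (Fin (d k)) ℝ) : replaceLayer W hk Y ⟨k, hk⟩ = Y :=
  Function.update_self ..

theorem replaceLayer_self (W : Weights H d) {k : ℕ} (hk : k < H + 1) :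
    replaceLayer W hk (W ⟨k, hk⟩) = W :=
  Function.update_eq_self ..

theorem partialProd_replaceLayer_below (W : Weights H d) {k a b : ℕ} (hk : k < H + 1)
    (Y : Matrix (Fin (d (k + 1))) (Fin (d k)) ℝ) (hab : a ≤ b) (hb : b ≤ H + 1) (hbk : b ≤ k) :
    partialProd (replaceLayer W hk Y) hab hb = partialProd W hab hb := by
  refine partialProd_congr hab hb fun j _ hj => Function.update_of_ne ?_ _ _
  rintro rfl
  exact absurd hj (not_lt.2 hbk)

theorem partialProd_replaceLayer_above (W : Weights H d) {k a b : ℕ} (hk : k < H + 1)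
    (Y : Matrix (Fin (d (k + 1))) (Fin (d k)) ℝ) (hab : a ≤ b) (hb : b ≤ H + 1) (hka : k < a) :
    partialProd (replaceLayer W hk Y) hab hb = partialProd W hab hb := by
  refine partialProd_congr hab hb fun j hj _ => Function.update_of_ne ?_ _ _
  rintro rfl
  exact absurd hj (not_le.2 hka)

theorem fullProd_eq (W : Weights H d) {k : ℕ} (hk : k < H + 1) :
    fullProd W = partialProd W (a := k + 1) hk le_rfl *
      (W ⟨k, hk⟩ : Matrix (Fin (d (k + 1))) (Fin (d k)) ℝ) *
        partialProd W (Nat.zero_le k) hk.le := by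
  rw [partialProd_mul_weight W hk hk le_rfl, partialProd_mul_partialProd]
  rfl

theorem fullProd_replaceLayer (W : Weights H d) {k : ℕ} (hk : k < H + 1)
    (Y : Matrix (Fin (d (k + 1))) (Fin (d k)) ℝ) :
    fullProd (replaceLayer W hk Y) =
      partialProd W (a := k + 1) hk le_rfl * Y * partialProd W (Nat.zero_le k) hk.le := by
  rw [fullProd_eq _ hk, replaceLayer_same, partialProd_replaceLayer_below W hk Y _ _ le_rfl,
    partialProd_replaceLayer_above W hk Y _ _ k.lt_succ_self]

theorem fullProd_replaceLayer_add (W : Weights H d) {k : ℕ} (hk : k < H + 1)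
    (Y : Matrix (Fin (d (k + 1))) (Fin (d k)) ℝ) :
    fullProd (replaceLayer W hk (W ⟨k, hk⟩ + Y)) = fullProd W +
      partialProd W (a := k + 1) hk le_rfl * Y * partialProd W (Nat.zero_le k) hk.le := by
  rw [fullProd_replaceLayer, fullProd_eq W hk, ← Matrix.add_mul, ← Matrix.mul_add]

theorem continuous_partialProd {a b : ℕ} (hab : a ≤ b) (hb : b ≤ H + 1) :
    Continuous fun W : Weights H d => partialProd W hab hb := by
  induction b, hab using Nat.le_induction with
  | base => simpa only [partialProd_self] using continuous_const
  | succ b hab ih =>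
    simp only [partialProd_succ _ hab hb]
    exact (continuous_apply (⟨b, hb⟩ : Fin (H + 1))).matrix_mul (ih (Nat.le_of_succ_le hb))

theorem continuous_fullProd : Continuous (fullProd : Weights H d → _) :=
  continuous_partialProd _ _

theorem continuous_replaceLayer (W : Weights H d) {k : ℕ} (hk : k < H + 1) :
    Continuous (replaceLayer W hk) :=
  continuous_const.update _ continuous_id

end PartialProducts

section LinearAlgebra

variable {m n p : ℕ}

/-- The rectangular identity matrix. -/
def rectOne (m n : ℕ) : Matrix (Fin m) (Fin n) ℝ :=
  Matrix.of fun i j => if (i : ℕ) = j then 1 else 0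

theorem rectOne_self (n : ℕ) : rectOne n n = 1 := by
  ext i j
  simp [rectOne, Matrix.one_apply, Fin.ext_iff]

theorem rectOne_mul_rectOne (h : m ≤ n ∨ p ≤ n) : rectOne m n * rectOne n p = rectOne m p := by
  ext i j
  simp only [rectOne, Matrix.mul_apply, Matrix.of_apply, ite_mul, one_mul, zero_mul]
  by_cases hi : (i : ℕ) < n
  · rw [Finset.sum_eq_single (⟨i, hi⟩ : Fin n)]
    · simp
    · intro b _ hb
      rw [if_neg]
      rintro h
      exact hb (Fin.ext h.symm)
    · simp
  · rw [Finset.sum_eq_zero, if_neg]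
    · omega
    · intro b _
      rw [if_neg]
      omega

theorem exists_vecMul_eq_zero_or_mul_left_cancel (M : Matrix (Fin m) (Fin n) ℝ) (h : n ≤ m) :
    (∃ v, v ≠ 0 ∧ v ᵥ* M = 0) ∨
      ∀ (p : ℕ) (Y : Matrix (Fin n) (Fin p) ℝ), M * Y = 0 → Y = 0 := by
  refine or_iff_not_imp_left.2 fun hv => ?_
  push Not at hv
  have hinj : Function.Injective M.vecMulLinear :=
    (injective_iff_map_eq_zero _).2 fun v hv' => by
      by_contra hne
      exact hv v hne hv'
  have hle := LinearMap.finrank_le_finrank_of_injective hinj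
  simp only [Module.finrank_fin_fun] at hle
  obtain rfl : m = n := le_antisymm hle h
  have hdet : M.det ≠ 0 := fun h0 => by
    obtain ⟨v, hne, hv'⟩ := Matrix.exists_vecMul_eq_zero_iff.2 h0
    exact hv v hne hv'
  intro p Y hY
  rw [← Matrix.nonsing_inv_mul_cancel_left M Y (isUnit_iff_ne_zero.2 hdet), hY, Matrix.mul_zero]

theorem exists_mulVec_eq_zero_or_mul_right_cancel (M : Matrix (Fin n) (Fin m) ℝ) (h : n ≤ m) :
    (∃ v, v ≠ 0 ∧ M *ᵥ v = 0) ∨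
      ∀ (p : ℕ) (Y : Matrix (Fin p) (Fin n) ℝ), Y * M = 0 → Y = 0 := by
  refine (exists_vecMul_eq_zero_or_mul_left_cancel Mᵀ h).imp ?_ ?_
  · simp only [Matrix.vecMul_transpose, imp_self]
  · intro hM p Y hY
    rw [← Matrix.transpose_eq_zero]
    exact hM p Yᵀ (by rw [← Matrix.transpose_mul, hY, Matrix.transpose_zero])

theorem exists_right_inverse_of_rank (M : Matrix (Fin m) (Fin n) ℝ) (h : M.rank = m) :
    ∃ R : Matrix (Fin n) (Fin m) ℝ, M * R = 1 := by
  rw [← Matrix.mulVec_surjective_iff_exists_right_inverse]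
  have : LinearMap.range M.mulVecLin = ⊤ :=
    Submodule.eq_top_of_finrank_eq (by simpa [Matrix.rank] using h)
  exact LinearMap.range_eq_top.1 this

theorem exists_left_inverse_of_rank (M : Matrix (Fin m) (Fin n) ℝ) (h : M.rank = n) :
    ∃ L : Matrix (Fin n) (Fin m) ℝ, L * M = 1 := by
  obtain ⟨R, hR⟩ := exists_right_inverse_of_rank Mᵀ (by rw [Matrix.rank_transpose, h])
  exact ⟨Rᵀ, by rw [← Matrix.transpose_inj, Matrix.transpose_mul, Matrix.transpose_transpose, hR,
    Matrix.transpose_one]⟩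

theorem exists_mul_add_smul_vecMulVec_ne_zero {X : Matrix (Fin p) (Fin m) ℝ} (hX : X ≠ 0)
    (Y : Matrix (Fin m) (Fin n) ℝ) {v : Fin n → ℝ} (hv : v ≠ 0) :
    ∃ w, ∀ t : ℝ, t ≠ 0 → X * Y = 0 → X * (Y + t • Matrix.vecMulVec w v) ≠ 0 := by
  obtain ⟨w, hw⟩ : ∃ w, X *ᵥ w ≠ 0 := by
    by_contra! h
    exact hX (Matrix.ext_of_mulVec_single fun i => by rw [h, Matrix.zero_mulVec])
  refine ⟨w, fun t ht h0 => ?_⟩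
  rw [Matrix.mul_add, h0, zero_add, Matrix.mul_smul, Matrix.mul_vecMulVec]
  obtain ⟨i, hi⟩ := Function.ne_iff.1 hw
  obtain ⟨j, hj⟩ := Function.ne_iff.1 hv
  exact smul_ne_zero ht fun h => mul_ne_zero hi hj (congrFun (congrFun h i) j)

theorem exists_add_smul_vecMulVec_mul_ne_zero {X : Matrix (Fin n) (Fin p) ℝ} (hX : X ≠ 0)
    (Y : Matrix (Fin m) (Fin n) ℝ) {v : Fin m → ℝ} (hv : v ≠ 0) :
    ∃ w, ∀ t : ℝ, t ≠ 0 → Y * X = 0 → (Y + t • Matrix.vecMulVec v w) * X ≠ 0 := by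
  obtain ⟨w, hw⟩ := exists_mul_add_smul_vecMulVec_ne_zero (X := Xᵀ)
    (by rwa [Ne, Matrix.transpose_eq_zero]) Yᵀ hv
  refine ⟨w, fun t ht h0 h => hw t ht (by rw [← Matrix.transpose_mul, h0, transpose_zero]) ?_⟩
  rw [← Matrix.transpose_vecMulVec, ← Matrix.transpose_smul, ← Matrix.transpose_add,
    ← Matrix.transpose_mul, h, transpose_zero]

theorem fderiv_eq_trace (f : Matrix (Fin m) (Fin n) ℝ → ℝ) (A M : Matrix (Fin m) (Fin n) ℝ) :
    fderiv ℝ f A M = ((matrixGradient f A)ᵀ * M).trace := by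
  conv_lhs => rw [Matrix.matrix_eq_sum_single M]
  simp only [map_sum, Matrix.trace, Matrix.diag, Matrix.mul_apply, Matrix.transpose_apply]
  rw [Finset.sum_comm]
  refine Finset.sum_congr rfl fun j _ => Finset.sum_congr rfl fun i _ => ?_
  have : Matrix.single i j (M i j) = M i j • Matrix.single i j (1 : ℝ) := by
    rw [Matrix.smul_single, smul_eq_mul, mul_one]
  rw [this, map_smul, smul_eq_mul, mul_comm]
  rfl

end LinearAlgebra

section Loss

variable {H : ℕ} {d : ℕ → ℕ} {l₀ : Matrix (Fin (d (H + 1))) (Fin (d 0)) ℝ → ℝ} {W : Weights H d}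

theorem hasDerivAt_loss_replaceLayer (hl₀ : Differentiable ℝ l₀) (W : Weights H d) {k : ℕ}
    (hk : k < H + 1) (Y : Matrix (Fin (d (k + 1))) (Fin (d k)) ℝ) :
    HasDerivAt (fun t : ℝ => loss l₀ (replaceLayer W hk (W ⟨k, hk⟩ + t • Y)))
      (((matrixGradient l₀ (fullProd W))ᵀ * (partialProd W (a := k + 1) hk le_rfl * Y *
        partialProd W (Nat.zero_le k) hk.le)).trace) 0 := by
  set B := partialProd W (a := k + 1) hk le_rfl * Y * partialProd W (Nat.zero_le k) hk.le
  have : HasDerivAt (fun t : ℝ => l₀ (fullProd W + t • B))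
      (((matrixGradient l₀ (fullProd W))ᵀ * B).trace) 0 :=
    HasDerivAt.congr_deriv ((hl₀ (fullProd W)).hasFDerivAt.hasLineDerivAt B)
      (fderiv_eq_trace l₀ (fullProd W) B)
  refine this.congr_of_eventuallyEq (Eventually.of_forall fun t => ?_)
  simp only [loss, fullProd_replaceLayer_add, B, Matrix.mul_smul,
    Matrix.smul_mul]

theorem partialProd_mul_gradient_mul_partialProd {k : ℕ} (hk : k < H + 1)
    (h : ∀ Y : Matrix (Fin (d (k + 1))) (Fin (d k)) ℝ,
      ((matrixGradient l₀ (fullProd W))ᵀ * (partialProd W (a := k + 1) hk le_rfl * Y *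
        partialProd W (Nat.zero_le k) hk.le)).trace = 0) :
    partialProd W (Nat.zero_le k) hk.le * (matrixGradient l₀ (fullProd W))ᵀ *
      partialProd W (a := k + 1) hk le_rfl = 0 := by
  refine Matrix.ext_iff_trace_mul_right.2 fun Y => ?_
  rw [Matrix.zero_mul, Matrix.trace_zero, ← h Y, Matrix.mul_assoc, Matrix.mul_assoc,
    Matrix.trace_mul_comm]
  simp only [Matrix.mul_assoc]

theorem IsCriticalPoint.hasDerivAt_line {E : Type*} [NormedAddCommGroup E] [NormedSpace ℝ E]
    {f : E → ℝ} {x : E} (h : IsCriticalPoint f x) (v : E) :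
    HasDerivAt (fun t : ℝ => f (x + t • v)) 0 0 :=
  HasFDerivAt.hasLineDerivAt h v

theorem continuous_replaceLayer_add_smul (W : Weights H d) {k : ℕ} (hk : k < H + 1)
    (Y : Matrix (Fin (d (k + 1))) (Fin (d k)) ℝ) :
    Continuous fun t : ℝ => replaceLayer W hk (W ⟨k, hk⟩ + t • Y) :=
  (continuous_replaceLayer W hk).comp (continuous_const.add (continuous_id.smul continuous_const))

theorem tendsto_replaceLayer_add_smul (W : Weights H d) {k : ℕ} (hk : k < H + 1)
    (Y : Matrix (Fin (d (k + 1))) (Fin (d k)) ℝ) :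
    Tendsto (fun t : ℝ => replaceLayer W hk (W ⟨k, hk⟩ + t • Y)) (𝓝 0) (𝓝 W) := by
  have := (continuous_replaceLayer_add_smul W hk Y).tendsto 0
  rwa [zero_smul, add_zero, replaceLayer_self] at this

theorem IsCriticalPoint.partialProd_mul_gradient (hl₀ : Differentiable ℝ l₀)
    (hW : IsCriticalPoint (loss l₀) W) {k : ℕ} (hk : k < H + 1) :
    partialProd W (Nat.zero_le k) hk.le * (matrixGradient l₀ (fullProd W))ᵀ *
      partialProd W (a := k + 1) hk le_rfl = 0 := by
  refine partialProd_mul_gradient_mul_partialProd hk fun Y => ?_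
  have hline := IsCriticalPoint.hasDerivAt_line hW (Pi.single (⟨k, hk⟩ : Fin (H + 1)) Y)
  refine (hasDerivAt_loss_replaceLayer hl₀ W hk Y).unique
    (hline.congr_of_eventuallyEq (Eventually.of_forall fun t => congrArg (loss l₀) ?_))
  refine funext fun j => ?_
  rcases eq_or_ne j ⟨k, hk⟩ with rfl | hj
  · simp [replaceLayer]
  · simp [replaceLayer, hj]

theorem IsLocalMin.partialProd_mul_gradient (hl₀ : Differentiable ℝ l₀)
    (hW : IsLocalMin (loss l₀) W) {k : ℕ} (hk : k < H + 1) :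
    partialProd W (Nat.zero_le k) hk.le * (matrixGradient l₀ (fullProd W))ᵀ *
      partialProd W (a := k + 1) hk le_rfl = 0 := by
  refine partialProd_mul_gradient_mul_partialProd hk fun Y => ?_
  refine IsLocalMin.hasDerivAt_eq_zero ?_ (hasDerivAt_loss_replaceLayer hl₀ W hk Y)
  filter_upwards [(tendsto_replaceLayer_add_smul W hk Y).eventually hW] with t ht
  rwa [zero_smul, add_zero, replaceLayer_self]

/-- A small rank-one change of one layer that does not affect the end-to-end product leads from a
local minimum to a local minimum. -/
theorem IsLocalMin.exists_replaceLayer_add_smul (hW : IsLocalMin (loss l₀) W) {k : ℕ}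
    (hk : k < H + 1) (Y : Matrix (Fin (d (k + 1))) (Fin (d k)) ℝ)
    (hY : partialProd W (a := k + 1) hk le_rfl * Y * partialProd W (Nat.zero_le k) hk.le = 0) :
    ∃ t : ℝ, t ≠ 0 ∧ IsLocalMin (loss l₀) (replaceLayer W hk (W ⟨k, hk⟩ + t • Y)) ∧
      fullProd (replaceLayer W hk (W ⟨k, hk⟩ + t • Y)) = fullProd W := by
  have hprod (t : ℝ) : fullProd (replaceLayer W hk (W ⟨k, hk⟩ + t • Y)) = fullProd W := by
    rw [fullProd_replaceLayer_add, Matrix.mul_smul, Matrix.smul_mul, hY, smul_zero, add_zero]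
  have hev := (tendsto_replaceLayer_add_smul W hk Y).eventually
    (eventually_eventually_nhds.2 hW)
  obtain ⟨t, ht, ht0⟩ :=
    ((hev.filter_mono nhdsWithin_le_nhds).and (self_mem_nhdsWithin (s := {0}ᶜ))).exists
  refine ⟨t, ht0, ht.mono fun V hV => ?_, hprod t⟩
  have hloss : loss l₀ (replaceLayer W hk (W ⟨k, hk⟩ + t • Y)) = loss l₀ W := by
    rw [loss, hprod, loss]
  rwa [hloss]

theorem not_isLocalMin_of_gradient_mul_partialProd_ne_zero (hl₀ : Differentiable ℝ l₀)
    (hd : ∀ j ≤ H, d 0 ≤ d j) {k : ℕ} (hk : k < H + 1) (W : Weights H d)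
    (hX : (matrixGradient l₀ (fullProd W))ᵀ * partialProd W (a := k + 1) hk le_rfl ≠ 0) :
    ¬ IsLocalMin (loss l₀) W := by
  induction k generalizing W with
  | zero =>
    intro hW
    have h := IsLocalMin.partialProd_mul_gradient hl₀ hW hk
    rw [partialProd_self, Matrix.one_mul] at h
    exact hX h
  | succ k ih =>
    intro hW
    rcases exists_vecMul_eq_zero_or_mul_left_cancel (partialProd W (Nat.zero_le (k + 1)) hk.le)
      (hd _ (Nat.lt_succ_iff.1 hk)) with ⟨v, hv, hv0⟩ | hc
    · have hk' : k < H + 1 := (Nat.lt_succ_self k).trans hk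
      obtain ⟨w, hw⟩ := exists_mul_add_smul_vecMulVec_ne_zero hX (W ⟨k + 1, hk⟩) hv
      by_cases h0 : (matrixGradient l₀ (fullProd W))ᵀ *
          partialProd W (a := k + 1 + 1) hk le_rfl *
          (W ⟨k + 1, hk⟩ : Matrix (Fin (d (k + 1 + 1))) (Fin (d (k + 1))) ℝ) = 0
      · obtain ⟨t, ht, hmin, hprod⟩ := IsLocalMin.exists_replaceLayer_add_smul hW hk
          (Matrix.vecMulVec w v)
          (by
            rw [Matrix.mul_assoc, Matrix.vecMulVec_mul, hv0]
            exact (congrArg _ (Matrix.ext fun i j => mul_zero (w i))).trans (Matrix.mul_zero _))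
        refine ih hk' _ ?_ hmin
        rw [hprod, ← partialProd_mul_weight _ hk hk le_rfl, replaceLayer_same,
          partialProd_replaceLayer_above _ _ _ _ _ (Nat.lt_succ_self _), ← Matrix.mul_assoc]
        exact hw t ht h0
      · refine ih hk' W ?_ hW
        rwa [← partialProd_mul_weight _ hk hk le_rfl, ← Matrix.mul_assoc]
    · refine hX (hc _ _ ?_)
      rw [← Matrix.mul_assoc]
      exact IsLocalMin.partialProd_mul_gradient hl₀ hW hk

theorem not_isLocalMin_of_partialProd_mul_gradient_ne_zero (hl₀ : Differentiable ℝ l₀)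
    (hd : ∀ j, 1 ≤ j → j ≤ H → d (H + 1) ≤ d j) {k : ℕ} (hk : k ≤ H) (W : Weights H d)
    (hX : partialProd W (Nat.zero_le k) (Nat.le_succ_of_le hk) *
      (matrixGradient l₀ (fullProd W))ᵀ ≠ 0) :
    ¬ IsLocalMin (loss l₀) W := by
  induction hk using Nat.decreasingInduction generalizing W with
  | self =>
    intro hW
    have h := IsLocalMin.partialProd_mul_gradient hl₀ hW (Nat.lt_succ_self H)
    rw [partialProd_self, Matrix.mul_one] at h
    exact hX h
  | of_succ k hkH ih =>
    intro hW
    have hk : k < H + 1 := Nat.lt_succ_of_lt hkH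
    rcases exists_mulVec_eq_zero_or_mul_right_cancel (partialProd W (a := k + 1) hk le_rfl)
      (hd _ (Nat.le_add_left 1 k) hkH) with ⟨v, hv, hv0⟩ | hc
    · obtain ⟨w, hw⟩ := exists_add_smul_vecMulVec_mul_ne_zero hX (W ⟨k, hk⟩) hv
      by_cases h0 : (W ⟨k, hk⟩ : Matrix (Fin (d (k + 1))) (Fin (d k)) ℝ) *
          (partialProd W (Nat.zero_le k) hk.le * (matrixGradient l₀ (fullProd W))ᵀ) = 0
      · obtain ⟨t, ht, hmin, hprod⟩ := IsLocalMin.exists_replaceLayer_add_smul hW hk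
          (Matrix.vecMulVec v w)
          (by rw [Matrix.mul_vecMulVec, hv0, Matrix.zero_vecMulVec, Matrix.zero_mul])
        refine ih _ ?_ hmin
        rw [hprod, partialProd_succ _ (Nat.zero_le k) hk, replaceLayer_same,
          partialProd_replaceLayer_below _ _ _ _ _ le_rfl, Matrix.mul_assoc]
        exact hw t ht h0
      · refine ih W ?_ hW
        rwa [partialProd_succ _ (Nat.zero_le k) hk, Matrix.mul_assoc]
    · exact hX (hc _ _ (IsLocalMin.partialProd_mul_gradient hl₀ hW hk))

theorem not_isLocalMin_loss_of_gradient_ne_zero (hl₀ : Differentiable ℝ l₀)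
    (hd : ∀ j, 1 ≤ j → j ≤ H → min (d 0) (d (H + 1)) ≤ d j)
    (hX : matrixGradient l₀ (fullProd W) ≠ 0) : ¬ IsLocalMin (loss l₀) W := by
  rcases le_total (d 0) (d (H + 1)) with h | h
  · refine not_isLocalMin_of_gradient_mul_partialProd_ne_zero hl₀ (fun j hj => ?_)
      (Nat.lt_succ_self H) W ?_
    · rcases Nat.eq_zero_or_pos j with rfl | hj0
      · exact le_rfl
      · simpa [h] using hd j hj0 hj
    · rwa [partialProd_self, Matrix.mul_one, Ne, Matrix.transpose_eq_zero]
  · refine not_isLocalMin_of_partialProd_mul_gradient_ne_zero hl₀ (fun j hj0 hj => ?_)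
      (Nat.zero_le H) W ?_
    · simpa [h] using hd j hj0 hj
    · rwa [partialProd_self, Matrix.one_mul, Ne, Matrix.transpose_eq_zero]

/-- The tuple of rectangular identity matrices. -/
def rectOneWeights (H : ℕ) (d : ℕ → ℕ) : Weights H d := fun _ => rectOne _ _

theorem partialProd_rectOneWeights_zero (hd : ∀ j ≤ H, d 0 ≤ d j) {k : ℕ} (hk : k ≤ H) :
    partialProd (rectOneWeights H d) (Nat.zero_le k) (Nat.le_succ_of_le hk) =
      rectOne (d k) (d 0) := by
  induction k with
  | zero => rw [partialProd_self, rectOne_self]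
  | succ k ih =>
    rw [partialProd_succ _ (Nat.zero_le k), ih (Nat.le_of_succ_le hk)]
    exact rectOne_mul_rectOne (Or.inr (hd k (Nat.le_of_succ_le hk)))

theorem partialProd_rectOneWeights_last (hd : ∀ j, 1 ≤ j → j ≤ H → d (H + 1) ≤ d j) {k : ℕ}
    (hk : k ≤ H) :
    partialProd (rectOneWeights H d) (Nat.succ_le_succ hk) le_rfl =
      rectOne (d (H + 1)) (d (k + 1)) := by
  induction hk using Nat.decreasingInduction with
  | self => rw [partialProd_self, rectOne_self]
  | of_succ k hk ih =>
    rw [← partialProd_mul_weight _ (Nat.succ_lt_succ hk) (Nat.succ_le_succ hk) le_rfl, ih]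
    exact rectOne_mul_rectOne (Or.inl (by
      rcases Nat.lt_or_ge (k + 1) H with h | h
      · exact hd (k + 2) (by omega) h
      · obtain rfl : k + 1 = H := le_antisymm hk h
        exact le_rfl))

theorem fullProd_surjective (hd : ∀ j, 1 ≤ j → j ≤ H → min (d 0) (d (H + 1)) ≤ d j) :
    Function.Surjective (fullProd : Weights H d → _) := by
  intro M
  rcases le_total (d 0) (d (H + 1)) with h | h
  · have hd' : ∀ j ≤ H, d 0 ≤ d j := fun j hj => by
      rcases Nat.eq_zero_or_pos j with rfl | hj0
      · exact le_rfl
      · simpa [h] using hd j hj0 hj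
    refine ⟨replaceLayer (rectOneWeights H d) (Nat.lt_succ_self H)
      (M * rectOne (d 0) (d H)), ?_⟩
    rw [fullProd_replaceLayer, partialProd_self, Matrix.one_mul,
      partialProd_rectOneWeights_zero hd' le_rfl, Matrix.mul_assoc,
      rectOne_mul_rectOne (Or.inl (hd' H le_rfl)), rectOne_self, Matrix.mul_one]
  · have hd' : ∀ j, 1 ≤ j → j ≤ H → d (H + 1) ≤ d j := fun j hj0 hj => by
      simpa [h] using hd j hj0 hj
    refine ⟨replaceLayer (rectOneWeights H d) (Nat.succ_pos H)
      (rectOne (d 1) (d (H + 1)) * M), ?_⟩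
    rw [fullProd_replaceLayer, partialProd_self, Matrix.mul_one,
      partialProd_rectOneWeights_last hd' (Nat.zero_le H), ← Matrix.mul_assoc,
      rectOne_mul_rectOne, rectOne_self, Matrix.one_mul]
    refine Or.inl ?_
    rcases Nat.eq_zero_or_pos H with rfl | hH
    · exact le_rfl
    · exact hd' 1 le_rfl hH

theorem isGlobalMin_loss_iff (hd : ∀ j, 1 ≤ j → j ≤ H → min (d 0) (d (H + 1)) ≤ d j) :
    IsGlobalMin (loss l₀) W ↔ IsGlobalMin l₀ (fullProd W) :=
  ((fullProd_surjective hd).forall (p := fun M => l₀ (fullProd W) ≤ l₀ M)).symm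

theorem isGlobalMax_loss_iff (hd : ∀ j, 1 ≤ j → j ≤ H → min (d 0) (d (H + 1)) ≤ d j) :
    IsGlobalMax (loss l₀) W ↔ IsGlobalMax l₀ (fullProd W) :=
  ((fullProd_surjective hd).forall (p := fun M => l₀ M ≤ l₀ (fullProd W))).symm

theorem isLocalMin_loss (h : IsLocalMin l₀ (fullProd W)) : IsLocalMin (loss l₀) W :=
  h.comp_continuous continuous_fullProd.continuousAt

theorem exists_layer_section {k : ℕ} (hk : k < H + 1)
    (h₁ : (partialProd W (a := k + 1) hk le_rfl).rank = d (H + 1))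
    (h₂ : (partialProd W (Nat.zero_le k) hk.le).rank = d 0) :
    ∃ s : Matrix (Fin (d (H + 1))) (Fin (d 0)) ℝ → Weights H d,
      Continuous s ∧ s (fullProd W) = W ∧ ∀ M, fullProd (s M) = M := by
  obtain ⟨R, hR⟩ := exists_right_inverse_of_rank _ h₁
  obtain ⟨L, hL⟩ := exists_left_inverse_of_rank _ h₂
  refine ⟨fun M => replaceLayer W hk (W ⟨k, hk⟩ + R * (M - fullProd W) * L), ?_, ?_, fun M => ?_⟩
  · refine (continuous_replaceLayer W hk).comp (continuous_const.add ?_)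
    exact (continuous_const.matrix_mul (continuous_id.sub continuous_const)).matrix_mul
      continuous_const
  · simp only [sub_self, Matrix.mul_zero, Matrix.zero_mul, add_zero, replaceLayer_self]
  · rw [fullProd_replaceLayer_add, ← Matrix.mul_assoc, ← Matrix.mul_assoc, hR, Matrix.one_mul,
      Matrix.mul_assoc, hL, Matrix.mul_one, add_sub_cancel]

theorem isLocalMin_of_section {s : Matrix (Fin (d (H + 1))) (Fin (d 0)) ℝ → Weights H d}
    (hs : Continuous s) (hsW : s (fullProd W) = W) (hsM : ∀ M, fullProd (s M) = M)
    (h : IsLocalMin (loss l₀) W) : IsLocalMin l₀ (fullProd W) := by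
  have h' : IsLocalMin (loss l₀) (s (fullProd W)) := by rwa [hsW]
  have := h'.comp_continuous hs.continuousAt
  have hc : loss l₀ ∘ s = l₀ := funext fun M => congrArg l₀ (hsM M)
  rwa [hc] at this

theorem IsCriticalPoint.gradient_eq_zero (hl₀ : Differentiable ℝ l₀)
    (hW : IsCriticalPoint (loss l₀) W) {k : ℕ} (hk : k < H + 1)
    (h₁ : (partialProd W (a := k + 1) hk le_rfl).rank = d (H + 1))
    (h₂ : (partialProd W (Nat.zero_le k) hk.le).rank = d 0) :
    matrixGradient l₀ (fullProd W) = 0 := by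
  obtain ⟨R, hR⟩ := exists_right_inverse_of_rank _ h₁
  obtain ⟨L, hL⟩ := exists_left_inverse_of_rank _ h₂
  have h := congrArg (fun Z => L * Z * R) (IsCriticalPoint.partialProd_mul_gradient hl₀ hW hk)
  simp only [Matrix.mul_zero, Matrix.zero_mul] at h
  rw [Matrix.mul_assoc, Matrix.mul_assoc, hR, Matrix.mul_one, ← Matrix.mul_assoc, hL,
    Matrix.one_mul, Matrix.transpose_eq_zero] at h
  exact h

theorem matrixGradient_neg {m n : ℕ} (f : Matrix (Fin m) (Fin n) ℝ → ℝ)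
    (A : Matrix (Fin m) (Fin n) ℝ) : matrixGradient (-f) A = -matrixGradient f A := by
  ext i j
  exact DFunLike.congr_fun (fderiv_neg (𝕜 := ℝ) (f := f) (x := A)) (Matrix.single i j 1)

theorem isLocalMin_neg_iff {α : Type*} [TopologicalSpace α] {f : α → ℝ} {x : α} :
    IsLocalMin (-f) x ↔ IsLocalMax f x := by
  simp only [IsLocalMin, IsLocalMax, IsMinFilter, IsMaxFilter, Pi.neg_apply, neg_le_neg_iff]

end Loss

end DeepLinear

theorem theorem3 (H : ℕ) (d : ℕ → ℕ)
    (hd : ∀ j, 1 ≤ j → j ≤ H → min (d 0) (d (H + 1)) ≤ d j)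
    (l₀ : Matrix (Fin (d (H + 1))) (Fin (d 0)) ℝ → ℝ) (hl₀ : Differentiable ℝ l₀)
    (W : DeepLinear.Weights H d)
    (hW : DeepLinear.IsCriticalPoint (DeepLinear.loss l₀) W) :
    -- Part 1
    (DeepLinear.matrixGradient l₀ (DeepLinear.fullProd W) ≠ 0 →
      DeepLinear.IsSaddle (DeepLinear.loss l₀) W) ∧
    -- Part 2
    (DeepLinear.matrixGradient l₀ (DeepLinear.fullProd W) = 0 →
      (IsLocalMin l₀ (DeepLinear.fullProd W) → IsLocalMin (DeepLinear.loss l₀) W) ∧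
      (IsLocalMax l₀ (DeepLinear.fullProd W) → IsLocalMax (DeepLinear.loss l₀) W) ∧
      (DeepLinear.IsGlobalMin (DeepLinear.loss l₀) W ↔
        DeepLinear.IsGlobalMin l₀ (DeepLinear.fullProd W)) ∧
      (DeepLinear.IsGlobalMax (DeepLinear.loss l₀) W ↔
        DeepLinear.IsGlobalMax l₀ (DeepLinear.fullProd W))) ∧
    -- Part 3: the matrix `W j` is `W_{j*}` with `j* = j + 1`
    ((∃ j : Fin (H + 1),
        (DeepLinear.partialProd W (a := j + 1) (b := H + 1) j.isLt le_rfl).rank = d (H + 1) ∧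
        (DeepLinear.partialProd W (a := 0) (b := j) (Nat.zero_le _) j.isLt.le).rank = d 0) →
      DeepLinear.matrixGradient l₀ (DeepLinear.fullProd W) = 0 ∧
      (IsLocalMin (DeepLinear.loss l₀) W ↔ IsLocalMin l₀ (DeepLinear.fullProd W)) ∧
      (IsLocalMax (DeepLinear.loss l₀) W ↔ IsLocalMax l₀ (DeepLinear.fullProd W)) ∧
      (DeepLinear.IsGlobalMin (DeepLinear.loss l₀) W ↔
        DeepLinear.IsGlobalMin l₀ (DeepLinear.fullProd W)) ∧
      (DeepLinear.IsGlobalMax (DeepLinear.loss l₀) W ↔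
        DeepLinear.IsGlobalMax l₀ (DeepLinear.fullProd W))) := by
  have key (f) (hf : Differentiable ℝ f)
      (hX : DeepLinear.matrixGradient f (DeepLinear.fullProd W) ≠ 0) :=
    DeepLinear.not_isLocalMin_loss_of_gradient_ne_zero hf hd hX
  have hmax : IsLocalMax l₀ (DeepLinear.fullProd W) → IsLocalMax (DeepLinear.loss l₀) W :=
    fun h => DeepLinear.isLocalMin_neg_iff.1
      (DeepLinear.isLocalMin_loss (l₀ := -l₀) (DeepLinear.isLocalMin_neg_iff.2 h))
  refine ⟨fun hX => ⟨hW, key l₀ hl₀ hX, fun h => key (-l₀) hl₀.neg ?_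
    (DeepLinear.isLocalMin_neg_iff.2 h)⟩, fun _ => ⟨DeepLinear.isLocalMin_loss, hmax,
    DeepLinear.isGlobalMin_loss_iff hd, DeepLinear.isGlobalMax_loss_iff hd⟩, ?_⟩
  · rwa [DeepLinear.matrixGradient_neg, neg_ne_zero]
  · rintro ⟨⟨k, hk⟩, h₁, h₂⟩
    obtain ⟨s, hs, hsW, hsM⟩ := DeepLinear.exists_layer_section hk h₁ h₂
    refine ⟨DeepLinear.IsCriticalPoint.gradient_eq_zero hl₀ hW hk h₁ h₂,
      ⟨DeepLinear.isLocalMin_of_section hs hsW hsM, DeepLinear.isLocalMin_loss⟩,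
      ⟨fun h => ?_, hmax⟩,
      DeepLinear.isGlobalMin_loss_iff hd, DeepLinear.isGlobalMax_loss_iff hd⟩
    exact DeepLinear.isLocalMin_neg_iff.1 (DeepLinear.isLocalMin_of_section (l₀ := -l₀) hs hsW hsM
      (DeepLinear.isLocalMin_neg_iff.2 h))
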